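/- Let $K\ge 2$ be a number of arms and $L\ge 1$ a number of resource types. Let $r_1,\dots,r_K$ satisfy $\tfrac12=r_1\ge r_2\ge\dots\ge r_K\ge\tfrac14$, and for every $\ell\in[L]$ let $1\ge d_{\ell,(1)}\ge d_{\ell,(2)}\ge\dots\ge d_{\ell,(K)}>0$. Put $d_{\ell,1}=d_{\ell,(2)}$, $d_{\ell,2}=d_{\ell,(1)}$ and $d_{\ell,k}=d_{\ell,(k)}$ for $3\le k\le K$. For budgets $C=(C_1,\dots,C_L)$ and $i\in[K]$ let $Q^{(i)}$ be the instance in which a pull of arm $k$ yields a Bernoulli reward with mean $r^{(i)}_k$, where $r^{(i)}_i=1-r_i$ and $r^{(i)}_k=r_k$ for $k\neq i$, and consumes exactly $d_{\ell,k}$ units of each resource $\ell$. A strategy $(\pi,\tau,\psi)$ pulls in step $t=1,2,\dots$ the arm $A(t)=\pi_t(O(1),\dots,O(t-1))$, where $\pi_t$ is a measurable function of the previous outcomes; given the past, the outcome $O(t)$ (the reward and the vector of consumptions) is drawn from the outcome distribution of arm $A(t)$. It stops after $\tau$ pulls, where $\tau$ is a stopping time for the filtration generated by the outcomes, and recommends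 an arm $\psi\in[K]$ that is a measurable function of the information available at time $\tau$. Let $\Pr_i$ be the law of the trajectory on $Q^{(i)}$. The strategy is feasible if, for every $i\in[K]$, $\Pr_i$-almost surely, $\tau<\infty$ and for every $\ell\in[L]$ the total consumption of resource $\ell$ during the first $\tau$ pulls is at most $C_\ell$. For an instance $Q$ with budgets $C_\ell$, let $r_{(1)}\ge\dots\ge r_{(K)}$ be its mean rewards and $d_{\ell,(1)}\ge\dots\ge d_{\ell,(K)}$ its mean consumptions of resource $\ell$, each sorted in non-increasing order, and set $$H^{\mathrm{det}}_{2,\ell}(Q)=\max_{2\le k\le K}\frac{\sum_{j=1}^k d_{\ell,(j)}}{(r_{(1)}-r_{(k)})^2},\qquad \gamma^{\mathrm{det}}(Q)=\min_{\ell\in[L]}\frac{C_\ell}{H^{\mathrm{det}}_{2,\ell}(Q)},$$ with the conventions $x/0=\infty$ for $x>0$ and $C_\ell/\infty=0$. Then there is a constant $C_0$, depending only on $K$, $L$, $(r_k)$ and $(d_{\ell,(k)})$, such that whenever $C_\ell\ge C_0$ for all $\ell\in[L]$, for every feasible strategy there is an $i\in[K]$ with $$\Pr\nolimits_i(\psi\neq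 i)\ \ge\ \frac16\exp\left(-122\cdot\gamma^{\mathrm{det}}(Q^{(i)})\right).$$ -/

import Mathlib

open MeasureTheory ProbabilityTheory
open scoped ENNReal

noncomputable section

namespace BAIwRC

/-- The outcome of one pull: the reward `R` and the consumption vector `(D_1, …, D_L)`. -/
abbrev Outcome (L : ℕ) : Type := ℝ × (Fin L → ℝ)

/-- The data of an instance of best arm identification with resource constraints, with `K` arms and
`L` types of resources: the budgets `C_1, …, C_L` and the outcome distributions `ν_1, …, ν_K`. -/
structure Inst (K L : ℕ) where
  budget : Fin L → ℝ
  law : Fin K → Measure (Outcome L)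
  isProb : ∀ k, IsProbabilityMeasure (law k)

/-- The values of `f` listed in non-increasing order, with multiplicity. -/
def sortDecreasing {K : ℕ} (f : Fin K → ℝ) : Fin K → ℝ :=
  fun k => f (Tuple.sort f k.rev)

namespace Inst

variable {K L : ℕ}

instance (Q : Inst K L) (k : Fin K) : IsProbabilityMeasure (Q.law k) := Q.isProb k

/-- The mean reward `r_k` of arm `k`. -/
def meanReward (Q : Inst K L) (k : Fin K) : ℝ := ∫ o, o.1 ∂(Q.law k)

/-- The mean consumption `d_{ℓ,k}` of resource `ℓ` by one pull of arm `k`. -/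
def meanConsumption (Q : Inst K L) (l : Fin L) (k : Fin K) : ℝ := ∫ o, o.2 l ∂(Q.law k)

/-- `H_{2,ℓ}^det(Q) = max_{2 ≤ k ≤ K} (∑_{j ≤ k} d_{ℓ,(j)}) / (r_{(1)} - r_{(k)})²`, where
`r_{(1)} ≥ … ≥ r_{(K)}` and `d_{ℓ,(1)} ≥ … ≥ d_{ℓ,(K)}` are the sorted mean rewards and mean
consumptions. Arms are indexed from `0`, so that `2 ≤ k` reads `0 < (k : ℕ)`. The value lives in
`[0, ∞]`: it is `∞` if two arms tie for the best mean reward and the consumptions are positive. -/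
def HTwoDet (Q : Inst K L) (l : Fin L) : ℝ≥0∞ :=
  ⨆ k : Fin K, ⨆ _ : 0 < (k : ℕ),
    ENNReal.ofReal (∑ j ∈ Finset.Iic k, sortDecreasing (Q.meanConsumption l) j) /
      ENNReal.ofReal
        ((sortDecreasing Q.meanReward ⟨0, k.pos⟩ - sortDecreasing Q.meanReward k) ^ 2)

/-- `γ^det(Q) = min_ℓ C_ℓ / H_{2,ℓ}^det(Q)`. -/
def gammaDet (Q : Inst K L) : ℝ≥0∞ :=
  ⨅ l : Fin L, ENNReal.ofReal (Q.budget l) / Q.HTwoDet l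

end Inst

/-- The filtration `σ(H(t))`, where `H(t)` consists of the first `t` outcomes. The outcome of the
`(s + 1)`-st pull is the coordinate `ω s`. -/
def histFiltration (L : ℕ) :
    Filtration ℕ (MeasurableSpace.pi : MeasurableSpace (ℕ → Outcome L)) where
  seq t := MeasurableSpace.comap (fun (ω : ℕ → Outcome L) (s : Fin t) => ω s) MeasurableSpace.pi
  mono' := by
    intro a b hab
    have h : (fun (ω : ℕ → Outcome L) (s : Fin a) => ω s) =
        (fun (h : Fin b → Outcome L) (s : Fin a) => h (Fin.castLE hab s)) ∘
          (fun (ω : ℕ → Outcome L) (s : Fin b) => ω s) := rfl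
    have hm : Measurable (fun (h : Fin b → Outcome L) (s : Fin a) => h (Fin.castLE hab s)) := by
      fun_prop
    change MeasurableSpace.comap _ _ ≤ MeasurableSpace.comap _ _
    rw [h, ← MeasurableSpace.comap_comp]
    exact MeasurableSpace.comap_mono hm.comap_le
  le' t := by
    have hm : Measurable (fun (ω : ℕ → Outcome L) (s : Fin t) => ω s) := by fun_prop
    exact hm.comap_le

/-- A strategy `(π, τ, ψ)`: `pull t` chooses the next arm from the first `t` outcomes, `tau` is the
number `τ` of pulls, a stopping time for the filtration `σ(H(t))`, and `recommend` is the arm `ψ`,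
chosen from the information available at time `τ`. -/
structure Strategy (K L : ℕ) where
  pull : (t : ℕ) → (Fin t → Outcome L) → Fin K
  measurable_pull : ∀ t, Measurable (pull t)
  tau : (ℕ → Outcome L) → WithTop ℕ
  isStoppingTime_tau : IsStoppingTime (histFiltration L) tau
  recommend : (ℕ → Outcome L) → Fin K
  measurable_recommend : Measurable[isStoppingTime_tau.measurableSpace] recommend

namespace Strategy

variable {K L : ℕ}

/-- The conditional law `ν_{A}` of the outcome of pull number `n + 2` given the first `n + 1`
outcomes, where `A` is the arm which the strategy pulls after these outcomes. -/
def stepKernel (S : Strategy K L) (Q : Inst K L) (n : ℕ) :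
    Kernel (Finset.Iic n → Outcome L) (Outcome L) :=
  (Kernel.ofFunOfCountable Q.law).comap
    (fun h => S.pull (n + 1)
      (fun s => h ⟨s, Finset.mem_Iic.mpr (Nat.lt_succ_iff.mp s.isLt)⟩))
    ((S.measurable_pull (n + 1)).comp (by fun_prop))

instance (S : Strategy K L) (Q : Inst K L) (n : ℕ) : IsMarkovKernel (S.stepKernel Q n) where
  isProbabilityMeasure _ := Q.isProb _

/-- The law of the sequence of outcomes when the arms are chosen by the strategy `S` and every
outcome is drawn from the distribution in `Q` of the arm that is pulled. -/
def trajLaw (S : Strategy K L) (Q : Inst K L) : Measure (ℕ → Outcome L) :=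
  Kernel.trajMeasure (X := fun _ => Outcome L) (Q.law (S.pull 0 Fin.elim0)) (S.stepKernel Q)

instance (S : Strategy K L) (Q : Inst K L) : IsProbabilityMeasure (S.trajLaw Q) := by
  unfold trajLaw; infer_instance

/-- Almost surely on `Q`, the strategy stops and its total consumption respects all budgets. -/
def Feasible (S : Strategy K L) (Q : Inst K L) : Prop :=
  ∀ᵐ ω ∂(S.trajLaw Q), ∃ n : ℕ, S.tau ω = n ∧
    ∀ l, ∑ t ∈ Finset.range n, (ω t).2 l ≤ Q.budget l

end Strategy

variable {K L : ℕ}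

/-- The mean rewards `r^{(i)}`: arm `i` has mean `1 - r_i`, every other arm `k` has mean `r_k`. -/
def flippedMean (r : Fin K → unitInterval) (i k : Fin K) : unitInterval :=
  if k = i then unitInterval.symm (r k) else r k

/-- The consumptions `d_{ℓ,k}`, made from the non-increasing sequence `d_{ℓ,(1)}, …, d_{ℓ,(K)}` by
exchanging its first two terms. -/
def arrangedConsumption (hK : 2 ≤ K) (d : Fin L → Fin K → ℝ) (l : Fin L) (k : Fin K) : ℝ :=
  if (k : ℕ) = 0 then d l ⟨1, by omega⟩
  else if (k : ℕ) = 1 then d l ⟨0, by omega⟩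
  else d l k

/-- The instance `Q^{(i)}` with budgets `C`: a pull of arm `k` yields a Bernoulli reward of mean
`r^{(i)}_k` and consumes exactly `d_{ℓ,k}` units of every resource `ℓ`. -/
def lowerBoundInst (hK : 2 ≤ K) (C : Fin L → ℝ) (r : Fin K → unitInterval)
    (d : Fin L → Fin K → ℝ) (i : Fin K) : Inst K L where
  budget := C
  law k := (bernoulliMeasure (1 : ℝ) 0 (flippedMean r i k)).prod
    (Measure.dirac (fun l => arrangedConsumption hK d l k))
  isProb _ := inferInstance

end BAIwRC

end

noncomputable section

namespace BAIwRC

variable {K L : ℕ}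

/-! The proof compares `Q^{(1)}`, whose arm 1 (index `0`) has mean `1/2` so that flipping it changes
nothing, with a single `Q^{(i)}`, which differs only in the reward of arm `i`. By Wald's identity
(`integral_stoppedLogLikelihood`) the divergence between the two stopped trajectories is `E T_i`,
the expectation under `Q^{(1)}`, times the Bernoulli divergence, which is at most `16 (1/2 - r_i)²`.
Bretagnolle–Huber then bounds the sum of the two error probabilities below by `exp (-16 (1/2 - r_i)²
E T_i) / 2` (`half_exp_le_error_add_error`).

The arm `i` comes from a pigeonhole argument (`exists_arm_mul_sq_gap_le`). Take the resource and the
index `k` that attain `γ^det(Q^{(1)})`; the budget cannot pay for many pulls of each of the arms `2,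
…, k`, so one of them satisfies `E T_i (1/2 - r_i)² ≤ 2 γ^det(Q^{(1)})`.

Flipping an arm only widens the sorted gaps, hence `γ^det(Q^{(1)}) ≤ γ^det(Q^{(i)})`
(`gammaDet_zero_le`), and the bound `exp (-32 γ^det(Q^{(1)})) / 2` on the sum gives the claim for
one of the two instances. -/

lemma pos_of_two_le {K : ℕ} (hK : 2 ≤ K) : 0 < K := Nat.lt_of_lt_of_le Nat.two_pos hK

/-! ### Histories, disintegration and change of measure at a fixed time. -/

/-- The first `n` outcomes. -/
def history (n : ℕ) (ω : ℕ → Outcome L) : Fin n → Outcome L := fun s => ω s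

@[fun_prop]
lemma measurable_history (n : ℕ) : Measurable (history n : (ℕ → Outcome L) → _) := by
  unfold history; fun_prop

lemma history_succ (n : ℕ) (ω : ℕ → Outcome L) :
    history (n + 1) ω = Fin.snoc (history n ω) (ω n) := by
  funext s
  refine Fin.lastCases ?_ (fun j => ?_) s
  · simp [history]
  · simp [history]

lemma measurable_snoc (n : ℕ) :
    Measurable (fun p : (Fin n → Outcome L) × Outcome L =>
      (Fin.snoc p.1 p.2 : Fin (n + 1) → Outcome L)) := by
  refine measurable_pi_iff.mpr fun s => ?_
  refine Fin.lastCases ?_ (fun j => ?_) s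
  · simpa using measurable_snd
  · simpa using! (measurable_pi_apply j).comp measurable_fst

lemma measurableSet_histFiltration_iff {n : ℕ} {s : Set (ℕ → Outcome L)} :
    MeasurableSet[histFiltration L n] s ↔
      ∃ B : Set (Fin n → Outcome L), MeasurableSet B ∧ history n ⁻¹' B = s := Iff.rfl

namespace Strategy

variable (S : Strategy K L)

/-- The arm pulled after `n` outcomes. -/
def arm (n : ℕ) (ω : ℕ → Outcome L) : Fin K := S.pull n (history n ω)

@[fun_prop]
lemma measurable_arm (n : ℕ) : Measurable (S.arm n) :=
  (S.measurable_pull n).comp (measurable_history n)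

/-- Disintegration of the law of the first `n + 1` outcomes. -/
lemma lintegral_trajLaw (Q : Inst K L) (n : ℕ) {G : (Fin n → Outcome L) × Outcome L → ℝ≥0∞}
    (hG : Measurable G) :
    ∫⁻ ω, G (history n ω, ω n) ∂(S.trajLaw Q) =
      ∫⁻ ω, ∫⁻ x, G (history n ω, x) ∂(Q.law (S.arm n ω)) ∂(S.trajLaw Q) := by
  cases n with
  | zero =>
    have h0 : ∀ ω : ℕ → Outcome L, history 0 ω = Fin.elim0 := fun ω => Subsingleton.elim _ _
    have hmap : (S.trajLaw Q).map (fun ω => ω 0) = Q.law (S.pull 0 Fin.elim0) := by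
      have h1 := Kernel.traj_map_frestrictLe (X := fun _ => Outcome L) (κ := S.stepKernel Q) 0 0
      rw [Kernel.partialTraj_self] at h1
      have h2 : (fun ω : ℕ → Outcome L => ω 0) =
          (fun x : (Finset.Iic 0 → Outcome L) => x ⟨0, by simp⟩) ∘
            (Preorder.frestrictLe (π := fun _ => Outcome L) 0) := rfl
      rw [h2, ← Measure.map_map (by fun_prop) (by fun_prop), trajLaw, Kernel.trajMeasure,
        Measure.map_comp _ _ (by fun_prop), h1, Measure.id_comp,
        Measure.map_map (by fun_prop) (by fun_prop)]
      exact Measure.map_id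
    simp only [h0, arm, lintegral_const, measure_univ, mul_one]
    rw [← hmap, lintegral_map (f := fun x => G (Fin.elim0, x)) (by fun_prop) (by fun_prop)]
  | succ n =>
    have h := Kernel.map_frestrictLe_trajMeasure_compProd_eq_map_trajMeasure
      (X := fun _ => Outcome L) (κ := S.stepKernel Q) (μ₀ := Q.law (S.pull 0 Fin.elim0)) (a := n)
    -- `stepKernel` indexes the past by `Finset.Iic n`, `history` by `Fin (n + 1)`; `e` translates
    -- between them.
    let e : (Finset.Iic n → Outcome L) → (Fin (n + 1) → Outcome L) :=
      fun h s => h ⟨s, Finset.mem_Iic.mpr (Nat.lt_succ_iff.mp s.isLt)⟩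
    have he : Measurable e := by fun_prop
    have hG' : Measurable (fun p : (Finset.Iic n → Outcome L) × Outcome L => G (e p.1, p.2)) := by
      fun_prop
    have h3 := congrArg (fun μ => ∫⁻ p, G (e p.1, p.2) ∂μ) h
    beta_reduce at h3
    rw [Measure.lintegral_compProd hG', lintegral_map hG'.lintegral_kernel_prod_right'
      (by fun_prop), lintegral_map hG' (by fun_prop)] at h3
    exact h3.symm

lemma trajLaw_inter (Q : Inst K L) (n : ℕ) (k : Fin K) {H : Set (Fin n → Outcome L)}
    (hH : MeasurableSet H) (hk : ∀ h ∈ H, S.pull n h = k) {B : Set (Outcome L)}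
    (hB : MeasurableSet B) :
    S.trajLaw Q {ω | history n ω ∈ H ∧ ω n ∈ B} =
      Q.law k B * S.trajLaw Q {ω | history n ω ∈ H} := by
  have h := S.lintegral_trajLaw Q n (G := (H ×ˢ B).indicator 1)
    (measurable_one.indicator (hH.prod hB))
  have h1 : ∀ ω : ℕ → Outcome L,
      (H ×ˢ B).indicator (1 : (Fin n → Outcome L) × Outcome L → ℝ≥0∞) (history n ω, ω n) =
        {ω | history n ω ∈ H ∧ ω n ∈ B}.indicator 1 ω := by
    classical
    intro ω
    simp [Set.indicator_apply, Set.mem_prod]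
  have h2 : ∀ ω : ℕ → Outcome L,
      ∫⁻ x, (H ×ˢ B).indicator (1 : (Fin n → Outcome L) × Outcome L → ℝ≥0∞) (history n ω, x)
          ∂(Q.law (S.arm n ω)) =
        {ω | history n ω ∈ H}.indicator (fun _ => Q.law k B) ω := by
    intro ω
    by_cases hω : history n ω ∈ H
    · have : ∀ x,
          (H ×ˢ B).indicator (1 : (Fin n → Outcome L) × Outcome L → ℝ≥0∞) (history n ω, x) =
            B.indicator 1 x := by
        intro x; classical simp [Set.indicator_apply, Set.mem_prod, hω]
      simp only [this]
      rw [lintegral_indicator_one hB, arm, hk _ hω]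
      simp [hω]
    · simp [hω]
  have hm1 : MeasurableSet {ω : ℕ → Outcome L | history n ω ∈ H} := measurable_history n hH
  have hm2 : MeasurableSet {ω : ℕ → Outcome L | history n ω ∈ H ∧ ω n ∈ B} :=
    hm1.inter (measurable_pi_apply n hB)
  rw [lintegral_congr h1, lintegral_congr h2] at h
  rwa [lintegral_indicator_one hm2, lintegral_indicator_const hm1] at h

/-- The likelihood ratio of the first `n` outcomes, for the likelihood ratios `f k` of the arms. -/
def likelihood (f : Fin K → Outcome L → ℝ) (n : ℕ) (ω : ℕ → Outcome L) : ℝ :=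
  ∏ t ∈ Finset.range n, f (S.arm t ω) (ω t)

/-- Factoring through the history makes the likelihood an admissible factor of the integrand in
`lintegral_trajLaw`. -/
lemma exists_likelihood_eq {f : Fin K → Outcome L → ℝ} (hf : ∀ k, Measurable (f k)) (n : ℕ) :
    ∃ g : (Fin n → Outcome L) → ℝ, Measurable g ∧ ∀ ω, S.likelihood f n ω = g (history n ω) := by
  refine ⟨fun h => ∏ t : Fin n,
    f (S.pull t (fun s : Fin t => h (Fin.castLE t.isLt.le s))) (h t), ?_, fun ω => ?_⟩
  · refine Finset.measurable_prod _ fun t _ => ?_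
    have : Measurable (fun p : Fin K × Outcome L => f p.1 p.2) :=
      measurable_from_prod_countable_right hf
    refine this.comp (Measurable.prodMk ((S.measurable_pull t).comp (by fun_prop)) (by fun_prop))
  · rw [likelihood, ← Fin.prod_univ_eq_prod_range (fun t => f (S.arm t ω) (ω t))]
    rfl

/-- Induction on the horizon: the last outcome is integrated out under `Q'`, the induction
hypothesis handles the remaining function of the history, and the density of the last arm supplies
the missing factor. -/
lemma lintegral_change_of_measure {Q Q' : Inst K L} {f : Fin K → Outcome L → ℝ}
    (hf : ∀ k, Measurable (f k)) (hf0 : ∀ k x, 0 ≤ f k x)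
    (hQ : ∀ k, Q'.law k = (Q.law k).withDensity (fun x => ENNReal.ofReal (f k x))) (n : ℕ)
    {g : (Fin n → Outcome L) → ℝ≥0∞} (hg : Measurable g) :
    ∫⁻ ω, g (history n ω) ∂(S.trajLaw Q') =
      ∫⁻ ω, ENNReal.ofReal (S.likelihood f n ω) * g (history n ω) ∂(S.trajLaw Q) := by
  induction n with
  | zero =>
    have h0 : ∀ ω : ℕ → Outcome L, history 0 ω = Fin.elim0 := fun ω => Subsingleton.elim _ _
    simp [h0, likelihood]
  | succ n ih =>
    obtain ⟨l, hl, hleq⟩ := S.exists_likelihood_eq hf n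
    have hfm : Measurable (fun p : Fin K × Outcome L => ENNReal.ofReal (f p.1 p.2)) :=
      (measurable_from_prod_countable_right hf).ennreal_ofReal
    have hgs : Measurable (fun p : (Fin n → Outcome L) × Outcome L => g (Fin.snoc p.1 p.2)) :=
      hg.comp (measurable_snoc n)
    have hfp : Measurable (fun p : (Fin n → Outcome L) × Outcome L =>
        ENNReal.ofReal (f (S.pull n p.1) p.2)) :=
      hfm.comp (((S.measurable_pull n).comp measurable_fst).prodMk measurable_snd)
    have hI : Measurable (fun h : Fin n → Outcome L => ∫⁻ x, g (Fin.snoc h x)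
        ∂(Q'.law (S.pull n h))) := by
      let κ := (Kernel.ofFunOfCountable Q'.law).comap (S.pull n) (S.measurable_pull n)
      have : IsMarkovKernel κ := ⟨fun _ => Q'.isProb _⟩
      exact Measurable.lintegral_kernel_prod_right' (κ := κ) hgs
    have h1 := S.lintegral_trajLaw Q' n hgs
    have h2 := S.lintegral_trajLaw Q n (G := fun p => ENNReal.ofReal (l p.1) *
      (ENNReal.ofReal (f (S.pull n p.1) p.2) * g (Fin.snoc p.1 p.2)))
      ((hl.ennreal_ofReal.comp measurable_fst).mul (hfp.mul hgs))
    simp only [history_succ]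
    rw [h1]
    have h3 := ih hI
    simp only at h2
    have e1 : ∀ ω : ℕ → Outcome L, ENNReal.ofReal (S.likelihood f (n + 1) ω) *
        g (Fin.snoc (history n ω) (ω n)) = ENNReal.ofReal (l (history n ω)) *
        (ENNReal.ofReal (f (S.pull n (history n ω)) (ω n)) * g (Fin.snoc (history n ω) (ω n))) := by
      intro ω
      rw [← mul_assoc, ← hleq, likelihood, Finset.prod_range_succ, ENNReal.ofReal_mul
        (Finset.prod_nonneg fun _ _ => hf0 _ _)]
      rfl
    simp only [e1]
    rw [h2]
    refine h3.trans (lintegral_congr fun ω => ?_)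
    have hgx : Measurable fun x => g (Fin.snoc (history n ω) x) :=
      hgs.comp (measurable_prodMk_left)
    rw [hleq, hQ, lintegral_withDensity_eq_lintegral_mul _ (hf _).ennreal_ofReal hgx]
    exact (lintegral_const_mul _ (((hf _).ennreal_ofReal).mul hgx)).symm

end Strategy

/-! ### The Bretagnolle–Huber inequality. -/

/-- With `a = exp m` and `y = exp (x / 2)`, the tangent of `exp` at `m` bounds the left side by `a y
- a² / 4 - a² y² / 4`. The squares `(a y / 2 - 1)²` and `(y - a / 2)²` give the two bounds.
Integrating this pointwise inequality replaces the usual Cauchy–Schwarz and Jensen steps. -/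
lemma sq_exp_mul_tangent_le_min_one_exp (m x : ℝ) :
    Real.exp m ^ 2 / 4 * (3 + 2 * x - 4 * m - Real.exp x) ≤ min 1 (Real.exp x) := by
  have hx : Real.exp x = Real.exp (x / 2) ^ 2 := by
    rw [← Real.exp_nat_mul]; congr 1; push_cast; ring
  have hy : Real.exp (x / 2) = Real.exp m * Real.exp (x / 2 - m) := by
    rw [← Real.exp_add]; congr 1; ring
  have ht := Real.add_one_le_exp (x / 2 - m)
  have ha := Real.exp_pos m
  set a := Real.exp m
  set y := Real.exp (x / 2)
  have hay : a ^ 2 * (x / 2 - m + 1) ≤ a * y := by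
    rw [hy]; nlinarith [mul_le_mul_of_nonneg_left ht (sq_nonneg a)]
  rw [hx, le_min_iff]
  constructor
  · nlinarith [sq_nonneg (a * y / 2 - 1)]
  · nlinarith [sq_nonneg (y - a / 2)]

/-- The Bretagnolle–Huber inequality for the measure with density `exp ∘ Λ`. -/
lemma half_exp_integral_le_setLIntegral_exp_add {Ω : Type*} [MeasurableSpace Ω] (μ : Measure Ω)
    [IsProbabilityMeasure μ] {Λ : Ω → ℝ} (hm : Measurable Λ) (hi : Integrable Λ μ)
    (h1 : ∫⁻ ω, ENNReal.ofReal (Real.exp (Λ ω)) ∂μ ≤ 1) {A : Set Ω} (hA : MeasurableSet A) :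
    1 / 2 * Real.exp (∫ ω, Λ ω ∂μ) ≤
      (∫⁻ ω in A, ENNReal.ofReal (Real.exp (Λ ω)) ∂μ).toReal + μ.real Aᶜ := by
  have hme : Measurable fun ω => Real.exp (Λ ω) := Real.measurable_exp.comp hm
  have hie : Integrable (fun ω => Real.exp (Λ ω)) μ := by
    refine ⟨hme.aestronglyMeasurable, ?_⟩
    rw [hasFiniteIntegral_iff_ofReal (Filter.Eventually.of_forall fun ω => (Real.exp_pos _).le)]
    exact h1.trans_lt ENNReal.one_lt_top
  have hint1 : ∫ ω, Real.exp (Λ ω) ∂μ ≤ 1 := by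
    rw [integral_eq_lintegral_of_nonneg_ae
      (Filter.Eventually.of_forall fun ω => (Real.exp_pos _).le)
      hme.aestronglyMeasurable]
    exact ENNReal.toReal_le_of_le_ofReal zero_le_one (by simpa using h1)
  have hset : (∫⁻ ω in A, ENNReal.ofReal (Real.exp (Λ ω)) ∂μ).toReal =
      ∫ ω in A, Real.exp (Λ ω) ∂μ :=
    (integral_eq_lintegral_of_nonneg_ae (Filter.Eventually.of_forall fun ω => (Real.exp_pos _).le)
      hme.aestronglyMeasurable).symm
  -- With this `m` the linear terms of `F` cancel in the mean; since `exp ∘ Λ` has mean at most `1`,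
  -- at least `2 · exp m ^ 2 / 4` remains.
  set m := (∫ ω, Λ ω ∂μ) / 2 with hmdef
  have hexp : Real.exp (∫ ω, Λ ω ∂μ) = Real.exp m ^ 2 := by
    rw [← Real.exp_nat_mul]; congr 1; push_cast; rw [hmdef]; ring
  let F : Ω → ℝ := fun ω => Real.exp m ^ 2 / 4 * (3 + 2 * Λ ω - 4 * m - Real.exp (Λ ω))
  have i1 : Integrable (fun ω => 3 + 2 * Λ ω) μ := (integrable_const _).add (hi.const_mul 2)
  have i2 : Integrable (fun ω => 3 + 2 * Λ ω - 4 * m) μ := i1.sub (integrable_const _)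
  have hF : Integrable F μ := (i2.sub hie).const_mul _
  have hFint : 1 / 2 * Real.exp m ^ 2 ≤ ∫ ω, F ω ∂μ := by
    simp only [F]
    rw [integral_const_mul, integral_sub i2 hie, integral_sub i1 (integrable_const _),
      integral_add (integrable_const _) (hi.const_mul 2), integral_const_mul]
    simp only [integral_const, probReal_univ, one_smul]
    have : ∫ ω, Λ ω ∂μ = 2 * m := by rw [hmdef]; ring
    rw [this]
    nlinarith [sq_nonneg (Real.exp m)]
  rw [hexp, hset]
  refine hFint.trans ?_
  rw [← integral_add_compl hA hF]
  refine add_le_add (integral_mono hF.integrableOn hie.integrableOn fun ω =>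
    (sq_exp_mul_tangent_le_min_one_exp m (Λ ω)).trans (min_le_right _ _)) ?_
  calc ∫ ω in Aᶜ, F ω ∂μ ≤ ∫ _ in Aᶜ, (1 : ℝ) ∂μ :=
        integral_mono hF.integrableOn (integrable_const _) fun ω =>
          (sq_exp_mul_tangent_le_min_one_exp m (Λ ω)).trans (min_le_left _ _)
    _ = μ.real Aᶜ := by simp

/-! ### Likelihood ratios and pull counts up to the stopping time. -/

namespace Strategy

variable (S : Strategy K L)

open Classical in
/-- The logarithm of the likelihood ratio of the outcomes before the stopping time, up to the
horizon `N`. -/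
def stoppedLogLikelihood (f : Fin K → Outcome L → ℝ) (N : ℕ) (ω : ℕ → Outcome L) : ℝ :=
  ∑ t ∈ Finset.range N, if (t : WithTop ℕ) < S.tau ω then Real.log (f (S.arm t ω) (ω t)) else 0

lemma measurableSet_lt_tau (t : ℕ) :
    MeasurableSet[histFiltration L t] {ω | (t : WithTop ℕ) < S.tau ω} := by
  have := (S.isStoppingTime_tau t).compl
  convert this using 1
  ext ω
  simp

lemma measurableSet_lt_tau' (t : ℕ) : MeasurableSet {ω | (t : WithTop ℕ) < S.tau ω} :=
  (histFiltration L).le t _ (S.measurableSet_lt_tau t)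

lemma measurable_arm_outcome {f : Fin K → Outcome L → ℝ} (hf : ∀ k, Measurable (f k)) (t : ℕ) :
    Measurable fun ω => f (S.arm t ω) (ω t) :=
  (measurable_from_prod_countable_right (f := fun p : Fin K × Outcome L => f p.1 p.2) hf).comp
    ((S.measurable_arm t).prodMk (measurable_pi_apply t))

lemma measurable_stoppedLogLikelihood {f : Fin K → Outcome L → ℝ} (hf : ∀ k, Measurable (f k))
    (N : ℕ) : Measurable (S.stoppedLogLikelihood f N) :=
  Finset.measurable_sum _ fun t _ => Measurable.ite (S.measurableSet_lt_tau' t)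
    (Real.measurable_log.comp (S.measurable_arm_outcome hf t)) measurable_const

lemma exp_stoppedLogLikelihood {f : Fin K → Outcome L → ℝ} (hf0 : ∀ k x, 0 < f k x) {n N : ℕ}
    (hn : n ≤ N) {ω : ℕ → Outcome L} (hω : S.tau ω = n) :
    Real.exp (S.stoppedLogLikelihood f N ω) = S.likelihood f n ω := by
  rw [stoppedLogLikelihood, likelihood, hω, ← Finset.sum_filter, Real.exp_sum]
  have : (Finset.range N).filter (fun t : ℕ => (t : WithTop ℕ) < (n : WithTop ℕ)) =
      Finset.range n := by
    ext t
    simp only [Finset.mem_filter, Finset.mem_range, Nat.cast_lt]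
    omega
  rw [this]
  exact Finset.prod_congr rfl fun t _ => Real.exp_log (hf0 _ _)

/-- Split `E` by the value of `τ`: each piece `E ∩ {τ = n}` is determined by `n` outcomes, so the
fixed-time change of measure is exact there. Only an inequality results, because `τ ≤ N` is assumed
under `Q` and `Q'` may charge the rest of `E`. -/
lemma setLIntegral_exp_stoppedLogLikelihood_le {Q Q' : Inst K L} {f : Fin K → Outcome L → ℝ}
    (hf : ∀ k, Measurable (f k)) (hf0 : ∀ k x, 0 < f k x)
    (hQ : ∀ k, Q'.law k = (Q.law k).withDensity (fun x => ENNReal.ofReal (f k x))) {N : ℕ}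
    (hN : ∀ᵐ ω ∂(S.trajLaw Q), S.tau ω ≤ N) {E : Set (ℕ → Outcome L)}
    (hE : MeasurableSet[S.isStoppingTime_tau.measurableSpace] E) :
    ∫⁻ ω in E, ENNReal.ofReal (Real.exp (S.stoppedLogLikelihood f N ω)) ∂(S.trajLaw Q) ≤
      S.trajLaw Q' E := by
  have hEm : MeasurableSet E := S.isStoppingTime_tau.measurableSpace_le _ hE
  let D : ℕ → Set (ℕ → Outcome L) := fun n => E ∩ {ω | S.tau ω = n}
  have hD : ∀ n, MeasurableSet[histFiltration L n] (D n) := fun n => by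
    have h1 := (S.isStoppingTime_tau.measurableSet E).1 hE |>.2 n
    have h2 := S.isStoppingTime_tau.measurableSet_eq n
    have : D n = (E ∩ {ω | S.tau ω ≤ n}) ∩ {ω | S.tau ω = n} := by
      ext ω
      simp only [D, Set.mem_inter_iff, Set.mem_ofPred_eq]
      constructor
      · rintro ⟨a, b⟩; exact ⟨⟨a, b.le⟩, b⟩
      · rintro ⟨⟨a, _⟩, b⟩; exact ⟨a, b⟩
    rw [this]
    exact h1.inter h2
  have hDm : ∀ n, MeasurableSet (D n) := fun n => (histFiltration L).le n _ (hD n)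
  have hdisj : Set.PairwiseDisjoint (↑(Finset.range (N + 1))) D := by
    intro a _ b _ hab
    refine Set.disjoint_left.mpr fun ω ha hb => hab ?_
    have := ha.2.symm.trans hb.2
    exact_mod_cast this
  have hkey : ∀ n ∈ Finset.range (N + 1), S.trajLaw Q' (D n) =
      ∫⁻ ω in D n, ENNReal.ofReal (Real.exp (S.stoppedLogLikelihood f N ω)) ∂(S.trajLaw Q) := by
    intro n hn
    obtain ⟨B, hB, hBD⟩ := measurableSet_histFiltration_iff.1 (hD n)
    have hc := S.lintegral_change_of_measure hf (fun k x => (hf0 k x).le) hQ n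
      (g := B.indicator 1) (measurable_one.indicator hB)
    have e1 : ∀ ω : ℕ → Outcome L, B.indicator (1 : (Fin n → Outcome L) → ℝ≥0∞) (history n ω) =
        (D n).indicator 1 ω := by
      intro ω
      rw [← hBD]
      rfl
    simp only [e1] at hc
    rw [lintegral_indicator_one (hDm n)] at hc
    rw [hc, ← lintegral_indicator (hDm n)]
    refine lintegral_congr fun ω => ?_
    by_cases hω : ω ∈ D n
    · simp [hω, S.exp_stoppedLogLikelihood hf0 (Nat.lt_succ_iff.1 (Finset.mem_range.1 hn)) hω.2]
    · simp [hω]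
  have hU : E =ᵐ[S.trajLaw Q] ⋃ n ∈ Finset.range (N + 1), D n := by
    filter_upwards [hN] with ω hω
    refine propext ⟨fun h => ?_, fun h => ?_⟩
    · obtain ⟨n, hn⟩ :=
        WithTop.ne_top_iff_exists.1 (ne_top_of_le_ne_top (WithTop.natCast_ne_top N) hω)
      have hnN : n ≤ N := by rw [← hn] at hω; exact WithTop.coe_le_coe.1 hω
      exact Set.mem_biUnion (x := n) (Finset.mem_coe.2 (Finset.mem_range.2 (by omega))) ⟨h, hn.symm⟩
    · obtain ⟨n, _, hn⟩ := Set.mem_iUnion₂.1 h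
      exact hn.1
  rw [setLIntegral_congr hU, lintegral_biUnion_finset hdisj fun n _ => hDm n,
    ← Finset.sum_congr rfl hkey, ← measure_biUnion_finset hdisj fun n _ => hDm n]
  exact measure_mono (Set.iUnion₂_subset fun n _ => Set.inter_subset_left)

/-- The number of pulls of arm `i` before the stopping time, up to the horizon `N`. -/
def pullCount (i : Fin K) (N : ℕ) (ω : ℕ → Outcome L) : ℝ :=
  ∑ t ∈ Finset.range N, 
    {ω | (t : WithTop ℕ) < S.tau ω ∧ S.arm t ω = i}.indicator (fun _ => (1 : ℝ)) ω

lemma measurableSet_pulled (i : Fin K) (t : ℕ) :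
    MeasurableSet[histFiltration L t] {ω | (t : WithTop ℕ) < S.tau ω ∧ S.arm t ω = i} := by
  refine (S.measurableSet_lt_tau t).inter ?_
  exact ⟨S.pull t ⁻¹' {i}, S.measurable_pull t (measurableSet_singleton i), rfl⟩

lemma measurableSet_pulled' (i : Fin K) (t : ℕ) :
    MeasurableSet {ω | (t : WithTop ℕ) < S.tau ω ∧ S.arm t ω = i} :=
  (histFiltration L).le t _ (S.measurableSet_pulled i t)

lemma integrable_pullCount (Q : Inst K L) (i : Fin K) (N : ℕ) :
    Integrable (S.pullCount i N) (S.trajLaw Q) := by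
  refine integrable_finsetSum _ fun t _ => ?_
  exact (integrable_const (1 : ℝ)).indicator (S.measurableSet_pulled' i t)

/-- Whether pull `t` takes place and uses arm `i` is decided by the earlier outcomes, so the new
outcome is a fresh draw from arm `i`. -/
lemma trajLaw_pulled_inter (Q : Inst K L) (i : Fin K) (t : ℕ) {B : Set (Outcome L)}
    (hB : MeasurableSet B) :
    (S.trajLaw Q).real {ω | ((t : WithTop ℕ) < S.tau ω ∧ S.arm t ω = i) ∧ ω t ∈ B} =
      (Q.law i).real B * (S.trajLaw Q).real {ω | (t : WithTop ℕ) < S.tau ω ∧ S.arm t ω = i} := by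
  obtain ⟨H, hH, hHU⟩ := measurableSet_histFiltration_iff.1 (S.measurableSet_lt_tau t)
  have hH' : MeasurableSet (H ∩ S.pull t ⁻¹' {i}) :=
    hH.inter (S.measurable_pull t (measurableSet_singleton i))
  have h := S.trajLaw_inter Q t i hH' (fun h hh => hh.2) hB
  have hiff : ∀ ω : ℕ → Outcome L, history t ω ∈ H ∩ S.pull t ⁻¹' {i} ↔
      ((t : WithTop ℕ) < S.tau ω ∧ S.arm t ω = i) := fun ω =>
    and_congr (Set.ext_iff.1 hHU ω) Iff.rfl
  simp only [hiff] at h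
  rw [measureReal_def, h, ENNReal.toReal_mul]
  rfl

/-- Wald's identity for the log-likelihood ratio of two instances which only differ in arm `i`,
where the log-likelihood ratio takes the values `c` and `-c`. -/
lemma integral_stoppedLogLikelihood (Q : Inst K L) {f : Fin K → Outcome L → ℝ} (i : Fin K)
    (hfi : ∀ k, k ≠ i → ∀ x, f k x = 1) {B : Set (Outcome L)} (hB : MeasurableSet B) (c : ℝ)
    (hB1 : ∀ x ∈ B, Real.log (f i x) = c) (hB0 : ∀ x ∉ B, Real.log (f i x) = -c) (N : ℕ) :
    Integrable (S.stoppedLogLikelihood f N) (S.trajLaw Q) ∧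
    ∫ ω, S.stoppedLogLikelihood f N ω ∂(S.trajLaw Q) =
      c * (2 * (Q.law i).real B - 1) * ∫ ω, S.pullCount i N ω ∂(S.trajLaw Q) := by
  classical
  let U : ℕ → Set (ℕ → Outcome L) := fun t => {ω | (t : WithTop ℕ) < S.tau ω ∧ S.arm t ω = i}
  have hU : ∀ t, MeasurableSet (U t) := S.measurableSet_pulled' i
  let V : ℕ → Set (Outcome L) → Set (ℕ → Outcome L) := fun t B => {ω | ω ∈ U t ∧ ω t ∈ B}
  have hV : ∀ t B, MeasurableSet B → MeasurableSet (V t B) := fun t B hB =>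
    (hU t).inter (measurable_pi_apply t hB)
  -- Only pulls of arm `i` contribute, namely `c` on `B` and `-c` off `B`, with conditional mean `c
  -- (2 P(B) - 1)`.
  have hterm : ∀ (t : ℕ) ω,
      (if (t : WithTop ℕ) < S.tau ω then Real.log (f (S.arm t ω) (ω t)) else 0) =
      (V t B).indicator (fun _ => c) ω + (V t Bᶜ).indicator (fun _ => -c) ω := by
    intro t ω
    by_cases h1 : (t : WithTop ℕ) < S.tau ω
    · by_cases h2 : S.arm t ω = i
      · by_cases h3 : ω t ∈ B
        · simp [V, U, h1, h2, h3, hB1]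
        · simp [V, U, h1, h2, h3, hB0]
      · simp [V, U, h2, hfi _ h2]
    · simp [V, U, h1]
  have hI : ∀ t B c, MeasurableSet B →
      Integrable ((V t B).indicator fun _ => (c : ℝ)) (S.trajLaw Q) :=
    fun t B c hB => (integrable_const c).indicator (hV t B hB)
  have heq : S.stoppedLogLikelihood f N = fun ω => ∑ t ∈ Finset.range N,
      ((V t B).indicator (fun _ => c) ω + (V t Bᶜ).indicator (fun _ => -c) ω) := by
    funext ω
    exact Finset.sum_congr rfl fun t _ => hterm t ω
  have hT : ∫ ω, S.pullCount i N ω ∂(S.trajLaw Q) =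
      ∑ t ∈ Finset.range N, (S.trajLaw Q).real (U t) := by
    unfold pullCount
    rw [integral_finsetSum]
    · refine Finset.sum_congr rfl fun t _ => ?_
      exact (integral_indicator_const (1 : ℝ) (hU t)).trans (by simp)
    · exact fun t _ => (integrable_const (1 : ℝ)).indicator (hU t)
  have hsum : ∀ t ∈ Finset.range N, Integrable (fun ω => (V t B).indicator (fun _ => c) ω +
      (V t Bᶜ).indicator (fun _ => -c) ω) (S.trajLaw Q) :=
    fun t _ => (hI t B c hB).add (hI t Bᶜ (-c) hB.compl)
  refine ⟨heq ▸ integrable_finsetSum _ hsum, ?_⟩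
  rw [hT, heq, integral_finsetSum _ hsum, Finset.mul_sum]
  refine Finset.sum_congr rfl fun t _ => ?_
  rw [integral_add (hI t B c hB) (hI t Bᶜ (-c) hB.compl), integral_indicator_const _ (hV t B hB),
    integral_indicator_const _ (hV t Bᶜ hB.compl)]
  have hVB := fun B (hB : MeasurableSet B) => S.trajLaw_pulled_inter Q i t hB
  simp only [V, U, Set.mem_ofPred_eq, hVB B hB, hVB Bᶜ hB.compl, probReal_compl_eq_one_sub hB,
    smul_eq_mul]
  ring

lemma ae_consumption_eq (Q : Inst K L) (v : Fin K → Fin L → ℝ)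
    (hv : ∀ k, ∀ᵐ x ∂(Q.law k), x.2 = v k) :
    ∀ᵐ ω ∂(S.trajLaw Q), ∀ t, (ω t).2 = v (S.arm t ω) := by
  refine ae_all_iff.2 fun t => ?_
  have h : ∀ k, ∀ᵐ ω ∂(S.trajLaw Q), ¬ (S.pull t (history t ω) = k ∧ (ω t).2 ≠ v k) := by
    intro k
    have hB : MeasurableSet {x : Outcome L | x.2 ≠ v k} :=
      (measurableSet_eq_fun measurable_snd measurable_const).compl
    have := S.trajLaw_inter Q t k (H := S.pull t ⁻¹' {k})
      (S.measurable_pull t (measurableSet_singleton k)) (fun h hh => hh) hB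
    have h0 : Q.law k {x : Outcome L | x.2 ≠ v k} = 0 := hv k
    rw [h0, zero_mul] at this
    rw [ae_iff]
    simp only [not_not]
    exact this
  filter_upwards [ae_all_iff.2 h] with ω hω
  by_contra hne
  exact hω _ ⟨rfl, hne⟩

end Strategy

/-! ### Sorted means, `γ^det`, and the choice of the arm to flip. -/

section GammaDet

lemma sortDecreasing_comp_perm {f : Fin K → ℝ} (hf : Antitone f) (σ : Equiv.Perm (Fin K)) :
    sortDecreasing (f ∘ σ) = f := by
  have h1 : f ∘ Fin.revPerm = f ∘ Tuple.sort f :=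
    Tuple.comp_sort_eq_comp_iff_monotone.2 fun a b hab => hf (by simpa using hab)
  have h2 : (f ∘ σ) ∘ Tuple.sort (f ∘ σ) = f ∘ Tuple.sort f :=
    Tuple.comp_perm_comp_sort_eq_comp_sort
  funext k
  have h3 := congrFun (h2.trans h1.symm) k.rev
  simpa using! h3

lemma sortDecreasing_of_antitone {f : Fin K → ℝ} (hf : Antitone f) : sortDecreasing f = f :=
  sortDecreasing_comp_perm hf (Equiv.refl _)

lemma antitone_sortDecreasing (f : Fin K → ℝ) : Antitone (sortDecreasing f) := fun _ _ hab =>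
  Tuple.monotone_sort f (Fin.rev_le_rev.2 hab)

lemma le_sortDecreasing_zero (f : Fin K → ℝ) (j : Fin K) :
    f j ≤ sortDecreasing f ⟨0, j.pos⟩ := by
  have h : f j = sortDecreasing f ((Tuple.sort f).symm j).rev := by simp [sortDecreasing]
  rw [h]
  exact antitone_sortDecreasing f (Fin.mk_le_of_le_val (Nat.zero_le _))

/-- Positions start at `0`: if the entry at position `k` exceeded `x`, so would the `k + 1` entries
at positions up to `k`. -/
lemma sortDecreasing_le {f : Fin K → ℝ} {k : Fin K} {x : ℝ}
    (h : (Finset.univ.filter fun j => x < f j).card ≤ k) : sortDecreasing f k ≤ x := by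
  by_contra! hx
  have hc := Finset.card_le_card_of_injOn (s := Finset.Iic k)
    (t := Finset.univ.filter fun j => x < f j) (fun j => Tuple.sort f j.rev)
    (fun j hj => by
      simpa using! hx.trans_le (antitone_sortDecreasing f (Finset.mem_Iic.1 hj)))
    (fun a _ b _ hab => Fin.rev_injective ((Tuple.sort f).injective hab))
  rw [Fin.card_Iic] at hc
  omega

variable (hK : 2 ≤ K) (C : Fin L → ℝ) (r : Fin K → unitInterval) (d : Fin L → Fin K → ℝ)

lemma lowerBoundInst_law (i k : Fin K) :
    (lowerBoundInst hK C r d i).law k = (bernoulliMeasure (1 : ℝ) 0 (flippedMean r i k)).prod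
      (Measure.dirac (fun l => arrangedConsumption hK d l k)) := rfl

lemma meanReward_lowerBoundInst (i : Fin K) :
    (lowerBoundInst hK C r d i).meanReward = fun k => (flippedMean r i k : ℝ) := by
  funext k
  rw [Inst.meanReward, lowerBoundInst_law, Measure.prod_dirac,
    integral_map (by fun_prop) (by fun_prop)]
  rw [integral_bernoulliMeasure]
  simp

lemma meanConsumption_lowerBoundInst (i : Fin K) (l : Fin L) :
    (lowerBoundInst hK C r d i).meanConsumption l = arrangedConsumption hK d l := by
  funext k
  rw [Inst.meanConsumption, lowerBoundInst_law, Measure.prod_dirac,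
    integral_map (by fun_prop) (by fun_prop)]
  simp

lemma arrangedConsumption_eq_comp_swap (l : Fin L) :
    arrangedConsumption hK d l = d l ∘ Equiv.swap ⟨0, pos_of_two_le hK⟩ ⟨1, by omega⟩ := by
  funext k
  simp only [arrangedConsumption, Function.comp, Equiv.swap_apply_def, Fin.ext_iff]
  split_ifs <;> rfl

lemma sortDecreasing_meanConsumption (hd : ∀ l, Antitone (d l)) (i : Fin K) (l : Fin L) :
    sortDecreasing ((lowerBoundInst hK C r d i).meanConsumption l) = d l := by
  rw [meanConsumption_lowerBoundInst, arrangedConsumption_eq_comp_swap]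
  exact sortDecreasing_comp_perm (hd l) _

variable {r d}

lemma flippedMean_zero (hr_first : (r ⟨0, pos_of_two_le hK⟩ : ℝ) = 1 / 2) :
    flippedMean r ⟨0, pos_of_two_le hK⟩ = r := by
  funext k
  unfold flippedMean
  split_ifs with h
  · subst h
    ext
    rw [unitInterval.coe_symm_eq, hr_first]
    norm_num
  · rfl

lemma sortDecreasing_meanReward_zero (hr_first : (r ⟨0, pos_of_two_le hK⟩ : ℝ) = 1 / 2)
    (hr_anti : Antitone r) :
    sortDecreasing (lowerBoundInst hK C r d ⟨0, pos_of_two_le hK⟩).meanReward =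
      fun k => (r k : ℝ) := by
  rw [meanReward_lowerBoundInst, flippedMean_zero hK hr_first]
  exact sortDecreasing_of_antitone fun a b hab => hr_anti hab

/-- Flipping the mean of arm `i` does not decrease any of the sorted gaps. -/
lemma gap_le_gap_flippedMean (hr_first : (r ⟨0, pos_of_two_le hK⟩ : ℝ) = 1 / 2)
    (hr_anti : Antitone r) (i k : Fin K) (hk : 0 < (k : ℕ)) :
    (1 / 2 : ℝ) - r k ≤ sortDecreasing (fun k => (flippedMean r i k : ℝ)) ⟨0, k.pos⟩ -
      sortDecreasing (fun k => (flippedMean r i k : ℝ)) k := by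
  have hle : ∀ j, (r j : ℝ) ≤ 1 / 2 := fun j => by
    rw [← hr_first]
    exact hr_anti (Fin.mk_le_of_le_val (Nat.zero_le _))
  have h0 : (1 : ℝ) - r i ≤ sortDecreasing (fun k => (flippedMean r i k : ℝ)) ⟨0, k.pos⟩ := by
    have := le_sortDecreasing_zero (fun k => (flippedMean r i k : ℝ)) i
    simpa [flippedMean] using this
  -- If `k ≤ i`, only arm `i` can exceed `1/2`, so the gap is at least `1/2 - r_i ≥ 1/2 - r_k`. If
  -- `i < k`, the arms exceeding `r_k` precede `k`, so the gap is at least `1 - r_i - r_k`.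
  rcases le_or_gt k i with hki | hki
  · have h1 : sortDecreasing (fun k => (flippedMean r i k : ℝ)) k ≤ 1 / 2 := by
      refine sortDecreasing_le ((Finset.card_le_card (t := {i}) fun j hj => ?_).trans hk)
      by_contra hne
      rw [Finset.mem_filter, flippedMean, if_neg (by simpa using hne)] at hj
      exact absurd hj.2 (hle j).not_gt
    have h2 : (r i : ℝ) ≤ r k := hr_anti hki
    linarith
  · have h1 : sortDecreasing (fun k => (flippedMean r i k : ℝ)) k ≤ r k := by
      refine sortDecreasing_le ((Finset.card_le_card (t := Finset.Iio k) fun j hj => ?_).trans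
        (Fin.card_Iio k).le)
      rw [Finset.mem_Iio]
      by_contra! hne
      rw [Finset.mem_filter, flippedMean, if_neg (hki.trans_le hne).ne'] at hj
      exact absurd hj.2 (not_lt.2 (hr_anti hne))
    linarith [hle i]

lemma gammaDet_zero_le (hr_first : (r ⟨0, pos_of_two_le hK⟩ : ℝ) = 1 / 2) (hr_anti : Antitone r)
    (hd : ∀ l, Antitone (d l)) (i : Fin K) :
    (lowerBoundInst hK C r d ⟨0, pos_of_two_le hK⟩).gammaDet ≤
      (lowerBoundInst hK C r d i).gammaDet := by
  refine iInf_mono fun l => ENNReal.div_le_div_left ?_ _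
  refine iSup_mono fun k => iSup_mono fun hk => ?_
  rw [sortDecreasing_meanConsumption hK C r d hd, sortDecreasing_meanConsumption hK C r d hd]
  refine ENNReal.div_le_div_left (ENNReal.ofReal_le_ofReal ?_) _
  rw [sortDecreasing_meanReward_zero hK C hr_first hr_anti, meanReward_lowerBoundInst]
  simp only [hr_first]
  refine pow_le_pow_left₀ ?_ (gap_le_gap_flippedMean hK hr_first hr_anti i k hk) 2
  have : (r k : ℝ) ≤ r ⟨0, pos_of_two_le hK⟩ := hr_anti (Fin.mk_le_of_le_val (Nat.zero_le _))
  rw [hr_first] at this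
  linarith

lemma HTwoDet_ne_zero (hd : ∀ l, Antitone (d l)) (hd0 : ∀ l k, 0 < d l k) (i : Fin K)
    (l : Fin L) : (lowerBoundInst hK C r d i).HTwoDet l ≠ 0 := by
  refine (lt_of_lt_of_le ?_ (le_iSup₂ (⟨1, by omega⟩ : Fin K) Nat.zero_lt_one)).ne'
  rw [sortDecreasing_meanConsumption hK C r d hd]
  exact ENNReal.div_pos (ENNReal.ofReal_pos.2
    (Finset.sum_pos (fun j _ => hd0 l j) ⟨⟨1, by omega⟩, by simp⟩)).ne'
    ENNReal.ofReal_ne_top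

/-- Since `toReal` sends `∞` to `0`, finiteness is needed to carry the comparison of `γ^det` over to
the reals. -/
lemma gammaDet_ne_top (hL : 1 ≤ L) (hd : ∀ l, Antitone (d l)) (hd0 : ∀ l k, 0 < d l k)
    (i : Fin K) : (lowerBoundInst hK C r d i).gammaDet ≠ ∞ :=
  ne_top_of_le_ne_top (ENNReal.div_ne_top ENNReal.ofReal_ne_top
    (HTwoDet_ne_zero hK C hd hd0 i ⟨0, hL⟩)) (iInf_le _ _)

lemma exists_gammaDet_zero_eq (hL : 1 ≤ L) (hC : ∀ l, 0 ≤ C l)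
    (hr_first : (r ⟨0, pos_of_two_le hK⟩ : ℝ) = 1 / 2) (hr_anti : Antitone r)
    (hd : ∀ l, Antitone (d l)) (hd0 : ∀ l k, 0 < d l k) :
    ∃ (l : Fin L) (k : Fin K), 0 < (k : ℕ) ∧
      (lowerBoundInst hK C r d ⟨0, pos_of_two_le hK⟩).gammaDet.toReal =
      C l * (1 / 2 - r k) ^ 2 / ∑ j ∈ Finset.Iic k, d l j := by
  have : Nonempty (Fin L) := ⟨⟨0, hL⟩⟩
  have : Nonempty (Fin K) := ⟨⟨0, pos_of_two_le hK⟩⟩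
  set Q := lowerBoundInst hK C r d ⟨0, pos_of_two_le hK⟩ with hQ
  obtain ⟨l, hl⟩ := exists_eq_ciInf_of_finite
    (f := fun l => ENNReal.ofReal (Q.budget l) / Q.HTwoDet l)
  obtain ⟨k, hk⟩ := exists_eq_ciSup_of_finite (f := fun k : Fin K => ⨆ _ : 0 < (k : ℕ),
    ENNReal.ofReal (∑ j ∈ Finset.Iic k, sortDecreasing (Q.meanConsumption l) j) /
      ENNReal.ofReal
        ((sortDecreasing Q.meanReward ⟨0, k.pos⟩ - sortDecreasing Q.meanReward k) ^ 2))
  change _ = Q.HTwoDet l at hk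
  -- Index `0` contributes an empty supremum, which is `0`, and so cannot attain the positive value
  -- `HTwoDet`.
  have hk0 : 0 < (k : ℕ) := by
    by_contra h
    simp only [h, iSup_false] at hk
    exact HTwoDet_ne_zero hK C hd hd0 _ l hk.symm
  refine ⟨l, k, hk0, ?_⟩
  change _ = Q.gammaDet at hl
  simp only [hk0, iSup_pos] at hk
  rw [← hl]
  -- The real formula also covers a tie `r_k = 1/2`: there `HTwoDet` is `∞`, and both sides are `0`.
  rw [← hk, hQ, sortDecreasing_meanConsumption hK C r d hd,
    sortDecreasing_meanReward_zero hK C hr_first hr_anti, ENNReal.toReal_div,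
    ENNReal.toReal_div, show (lowerBoundInst hK C r d ⟨0, pos_of_two_le hK⟩).budget l = C l
      from rfl,
    ENNReal.toReal_ofReal (hC l), ENNReal.toReal_ofReal (sq_nonneg _),
    ENNReal.toReal_ofReal (Finset.sum_nonneg fun j _ => (hd0 l j).le), div_div_eq_mul_div]
  simp only [hr_first]

/-- This is what the exchange of the first two consumptions is for: arm 1 consumes no more than arm
2, so leaving out arm 1 loses at most half of the sum. -/
lemma sum_Iic_le_two_mul_sum_arrangedConsumption (l : Fin L) (hd : Antitone (d l))
    (hd0 : ∀ k, 0 < d l k)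
    {k : Fin K} (hk : 0 < (k : ℕ)) :
    ∑ j ∈ Finset.Iic k, d l j ≤
      2 * ∑ j ∈ (Finset.Iic k).erase ⟨0, pos_of_two_le hK⟩, arrangedConsumption hK d l j := by
  have h1 : ∑ j ∈ Finset.Iic k, d l j = ∑ j ∈ Finset.Iic k, arrangedConsumption hK d l j := by
    refine (Finset.sum_equiv (Equiv.swap (⟨0, pos_of_two_le hK⟩ : Fin K) ⟨1, by omega⟩)
      (fun j => ?_)
      fun j _ => ?_).symm
    · simp only [Finset.mem_Iic, Equiv.swap_apply_def, Fin.ext_iff]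
      split_ifs <;> simp only [Fin.le_def] <;> omega
    · rw [arrangedConsumption_eq_comp_swap]; rfl
  have h0 : (⟨0, pos_of_two_le hK⟩ : Fin K) ∈ Finset.Iic k := by simp [Fin.le_def]
  have hpos : ∀ j, 0 < arrangedConsumption hK d l j := fun j => by
    rw [arrangedConsumption_eq_comp_swap]; exact hd0 _
  have h2 : arrangedConsumption hK d l ⟨1, by omega⟩ ≤
      ∑ j ∈ (Finset.Iic k).erase ⟨0, pos_of_two_le hK⟩, arrangedConsumption hK d l j :=
    Finset.single_le_sum (f := arrangedConsumption hK d l) (fun j _ => (hpos j).le)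
      (by simp [Fin.le_def, Fin.ext_iff]; omega)
  have h3 : arrangedConsumption hK d l ⟨0, pos_of_two_le hK⟩ ≤
      arrangedConsumption hK d l ⟨1, by omega⟩ := by
    simp only [arrangedConsumption, if_true, one_ne_zero, if_false]
    exact hd (by simp [Fin.le_def])
  rw [h1, ← Finset.add_sum_erase _ _ h0]
  linarith

lemma exists_arm_mul_sq_gap_le (hL : 1 ≤ L) (hC : ∀ l, 0 ≤ C l)
    (hr_first : (r ⟨0, pos_of_two_le hK⟩ : ℝ) = 1 / 2) (hr_anti : Antitone r)
    (hd : ∀ l, Antitone (d l)) (hd0 : ∀ l k, 0 < d l k) {T : Fin K → ℝ} (hT0 : ∀ k, 0 ≤ T k)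
    (hT : ∀ l, ∑ k, arrangedConsumption hK d l k * T k ≤ C l) :
    ∃ i : Fin K, i ≠ ⟨0, pos_of_two_le hK⟩ ∧ T i * (1 / 2 - r i) ^ 2 ≤
      2 * (lowerBoundInst hK C r d ⟨0, pos_of_two_le hK⟩).gammaDet.toReal := by
  obtain ⟨l, k, hk, hγ⟩ := exists_gammaDet_zero_eq hK C hL hC hr_first hr_anti hd hd0
  rw [hγ]
  have hpos : ∀ j, 0 < arrangedConsumption hK d l j := fun j => by
    rw [arrangedConsumption_eq_comp_swap]; exact hd0 _ _
  have hS := sum_Iic_le_two_mul_sum_arrangedConsumption hK l (hd l) (hd0 l) hk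
  have hSpos : 0 < ∑ j ∈ Finset.Iic k, d l j := Finset.sum_pos (fun j _ => hd0 l j) ⟨k, by simp⟩
  set D := ∑ j ∈ Finset.Iic k, d l j
  set I := (Finset.Iic k).erase (⟨0, pos_of_two_le hK⟩ : Fin K)
  have hne : I.Nonempty := ⟨k, by simp [I, Fin.ext_iff]; omega⟩
  -- Otherwise the arms in `I`, whose consumptions sum to at least `D / 2`, would use more than `D /
  -- 2 · 2 C_ℓ / D = C_ℓ`.
  obtain ⟨i, hi, hTi⟩ : ∃ i ∈ I, T i ≤ 2 * C l / D := by
    by_contra! h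
    have h1 : ∑ j ∈ I, arrangedConsumption hK d l j * (2 * C l / D) <
        ∑ j ∈ I, arrangedConsumption hK d l j * T j :=
      Finset.sum_lt_sum_of_nonempty hne fun j hj => mul_lt_mul_of_pos_left (h j hj) (hpos j)
    have h2 : ∑ j ∈ I, arrangedConsumption hK d l j * T j ≤ C l :=
      (Finset.sum_le_univ_sum_of_nonneg fun j => mul_nonneg (hpos j).le (hT0 j)).trans (hT l)
    rw [← Finset.sum_mul] at h1
    have h3 : D / 2 * (2 * C l / D) ≤
        (∑ j ∈ I, arrangedConsumption hK d l j) * (2 * C l / D) :=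
      mul_le_mul_of_nonneg_right (by linarith) (div_nonneg (by linarith [hC l]) hSpos.le)
    have h4 : D / 2 * (2 * C l / D) = C l := by field_simp
    linarith
  have hik : i ≤ k := by simpa using (Finset.mem_erase.1 hi).2
  refine ⟨i, (Finset.mem_erase.1 hi).1, ?_⟩
  have h1 : (r k : ℝ) ≤ r i := hr_anti hik
  have h2 : (r i : ℝ) ≤ 1 / 2 := by
    rw [← hr_first]; exact hr_anti (Fin.mk_le_of_le_val (Nat.zero_le _))
  calc T i * (1 / 2 - r i) ^ 2 ≤ 2 * C l / D * (1 / 2 - r k) ^ 2 := by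
        refine mul_le_mul hTi (pow_le_pow_left₀ (by linarith) (by linarith) 2) (sq_nonneg _)
          (div_nonneg (by linarith [hC l]) hSpos.le)
    _ = 2 * (C l * (1 / 2 - r k) ^ 2 / D) := by ring

end GammaDet

/-! ### Feasibility as a bound on the stopping time and the expected pulls. -/

lemma Strategy.Feasible.exists_horizon {S : Strategy K L} {Q : Inst K L} (hS : S.Feasible Q)
    (hL : 1 ≤ L) {v : Fin K → Fin L → ℝ} (hv : ∀ k, ∀ᵐ x ∂(Q.law k), x.2 = v k)
    (hv0 : ∀ k l, 0 < v k l) :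
    ∃ N : ℕ, (∀ᵐ ω ∂(S.trajLaw Q), S.tau ω ≤ N) ∧
      ∀ l, ∑ k, v k l * ∫ ω, S.pullCount k N ω ∂(S.trajLaw Q) ≤ Q.budget l := by
  classical
  have : Nonempty (Fin K) := ⟨S.pull 0 Fin.elim0⟩
  obtain ⟨k₀, hk₀⟩ := Finite.exists_min fun k => v k ⟨0, hL⟩
  have hae : ∀ᵐ ω ∂(S.trajLaw Q), ∃ n : ℕ, S.tau ω = n ∧
      ∀ l, ∑ t ∈ Finset.range n, v (S.arm t ω) l ≤ Q.budget l := by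
    filter_upwards [hS, S.ae_consumption_eq Q v hv] with ω ⟨n, hn, hle⟩ hω
    refine ⟨n, hn, fun l => ?_⟩
    simpa only [hω] using hle l
  -- Each pull costs at least the smallest consumption of the first resource, so its budget bounds
  -- `τ` by a deterministic `N`.
  obtain ⟨N, hN⟩ := exists_nat_ge (Q.budget ⟨0, hL⟩ / v k₀ ⟨0, hL⟩)
  have hbound : ∀ᵐ ω ∂(S.trajLaw Q), ∃ n : ℕ, n ≤ N ∧ S.tau ω = n ∧
      ∀ l, ∑ t ∈ Finset.range n, v (S.arm t ω) l ≤ Q.budget l := by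
    filter_upwards [hae] with ω ⟨n, hn, hle⟩
    refine ⟨n, ?_, hn, hle⟩
    have h1 : (n : ℝ) * v k₀ ⟨0, hL⟩ ≤ Q.budget ⟨0, hL⟩ := by
      refine le_trans ?_ (hle ⟨0, hL⟩)
      simpa using Finset.card_nsmul_le_sum (Finset.range n) (fun t => v (S.arm t ω) ⟨0, hL⟩) _
        fun t _ => hk₀ _
    have h2 : (n : ℝ) ≤ N := ((le_div_iff₀ (hv0 _ _)).2 h1).trans hN
    exact_mod_cast h2
  refine ⟨N, ?_, fun l => ?_⟩
  · filter_upwards [hbound] with ω ⟨n, hnN, hn, _⟩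
    rw [hn]
    exact WithTop.coe_le_coe.2 hnN
  · have hint : ∀ k ∈ Finset.univ, Integrable (fun ω => v k l * S.pullCount k N ω) (S.trajLaw Q) :=
      fun k _ => (S.integrable_pullCount Q k N).const_mul _
    calc ∑ k, v k l * ∫ ω, S.pullCount k N ω ∂(S.trajLaw Q)
        = ∫ ω, ∑ k, v k l * S.pullCount k N ω ∂(S.trajLaw Q) := by
          rw [integral_finsetSum _ hint]
          simp only [integral_const_mul]
      _ ≤ ∫ _, Q.budget l ∂(S.trajLaw Q) := by
          refine integral_mono_ae (integrable_finsetSum _ hint) (integrable_const _) ?_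
          filter_upwards [hbound] with ω ⟨n, hnN, hn, hle⟩
          refine le_trans (le_of_eq ?_) (hle l)
          have hf : (Finset.range N).filter (fun t : ℕ => (t : WithTop ℕ) < (n : WithTop ℕ)) =
              Finset.range n := by
            ext t
            simp only [Finset.mem_filter, Finset.mem_range, Nat.cast_lt]
            omega
          simp only [Strategy.pullCount, Finset.mul_sum]
          rw [Finset.sum_comm, ← hf, Finset.sum_filter]
          refine Finset.sum_congr rfl fun t _ => ?_
          simp only [Set.indicator_apply, Set.mem_ofPred_eq, hn, mul_ite, mul_one, mul_zero]
          by_cases ht : (t : WithTop ℕ) < (n : WithTop ℕ)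
          · simp [ht]
          · simp [ht]
      _ = Q.budget l := by simp

/-! ### Flipped Bernoulli arms and the two-instance error bound. -/

lemma bernoulliMeasure_symm_eq_withDensity {X : Type*} [MeasurableSpace X]
    [MeasurableSingletonClass X] (x y : X) (p : unitInterval) (hp0 : 0 < (p : ℝ))
    (hp1 : (p : ℝ) < 1) {f : X → ℝ} (hx : f x = (1 - p) / p)
    (hy : f y = p / (1 - p)) :
    bernoulliMeasure x y (unitInterval.symm p) =
      (bernoulliMeasure x y p).withDensity fun z => ENNReal.ofReal (f z) := by
  have h1 : 0 < 1 - (p : ℝ) := by linarith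
  have e : ∀ q : unitInterval, ((unitInterval.toNNReal q : NNReal) : ℝ≥0∞) = ENNReal.ofReal q := by
    intro q
    rw [ENNReal.ofReal]
    congr 1
    ext
    simp [q.2.1]
  ext s hs
  rw [withDensity_apply _ hs, ← lintegral_indicator hs]
  simp only [bernoulliMeasure_def, lintegral_add_measure, lintegral_smul_measure, lintegral_dirac,
    Measure.add_apply, Measure.smul_apply, Measure.dirac_apply' _ hs, unitInterval.symm_symm,
    ENNReal.smul_def, smul_eq_mul, e]
  have hx' : s.indicator (fun z => ENNReal.ofReal (f z)) x =
      ENNReal.ofReal ((1 - p) / p) * s.indicator 1 x := by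
    by_cases h : x ∈ s <;> simp [h, hx]
  have hy' : s.indicator (fun z => ENNReal.ofReal (f z)) y =
      ENNReal.ofReal (p / (1 - p)) * s.indicator 1 y := by
    by_cases h : y ∈ s <;> simp [h, hy]
  rw [hx', hy', ← mul_assoc, ← mul_assoc, ← ENNReal.ofReal_mul p.2.1,
    ← ENNReal.ofReal_mul (by simpa using h1.le), unitInterval.coe_symm_eq,
    mul_div_cancel₀ _ hp0.ne', mul_div_cancel₀ _ h1.ne']

lemma bernoulliMeasure_prod_dirac (p : unitInterval) (v : Fin L → ℝ) :
    (bernoulliMeasure (1 : ℝ) 0 p).prod (Measure.dirac v) =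
      bernoulliMeasure ((1, v) : Outcome L) (0, v) p := by
  rw [Measure.prod_dirac, map_bernoulliMeasure' _ _ (by fun_prop)]

/-- The likelihood ratio of the outcome of arm `k` when the Bernoulli mean `p` of the reward of arm
`i` is replaced by `1 - p`. -/
def flipRatio (p : ℝ) (i k : Fin K) (x : Outcome L) : ℝ :=
  if k = i then if x.1 = 1 then (1 - p) / p else p / (1 - p) else 1

lemma measurableSet_fst_eq_one : MeasurableSet {x : Outcome L | x.1 = 1} :=
  measurable_fst (measurableSet_singleton 1)

lemma measurable_flipRatio (p : ℝ) (i k : Fin K) :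
    Measurable (flipRatio p i k : Outcome L → ℝ) := by
  unfold flipRatio
  split_ifs
  · exact Measurable.ite measurableSet_fst_eq_one measurable_const measurable_const
  · exact measurable_const

lemma flipRatio_pos {p : ℝ} (hp0 : 0 < p) (hp1 : p < 1) (i k : Fin K) (x : Outcome L) :
    0 < flipRatio p i k x := by
  have : 0 < 1 - p := by linarith
  unfold flipRatio
  split_ifs <;> positivity

variable (hK : 2 ≤ K) (C : Fin L → ℝ) {r : Fin K → unitInterval} (d : Fin L → Fin K → ℝ)

lemma lowerBoundInst_law_eq_withDensity (hr_first : (r ⟨0, pos_of_two_le hK⟩ : ℝ) = 1 / 2)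
    (i k : Fin K)
    (h0 : 0 < (r i : ℝ)) (h1 : (r i : ℝ) < 1) :
    (lowerBoundInst hK C r d i).law k =
      ((lowerBoundInst hK C r d ⟨0, pos_of_two_le hK⟩).law k).withDensity
        fun x => ENNReal.ofReal (flipRatio (r i) i k x) := by
  rw [lowerBoundInst_law, lowerBoundInst_law, flippedMean_zero hK hr_first]
  by_cases hk : k = i
  · subst hk
    rw [flippedMean, if_pos rfl, bernoulliMeasure_prod_dirac, bernoulliMeasure_prod_dirac]
    exact bernoulliMeasure_symm_eq_withDensity _ _ _ h0 h1 (by simp [flipRatio])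
      (by simp [flipRatio])
  · simp [flippedMean, flipRatio, hk]

lemma ae_consumption_lowerBoundInst (i k : Fin K) :
    ∀ᵐ x ∂((lowerBoundInst hK C r d i).law k), x.2 = fun l => arrangedConsumption hK d l k := by
  rw [lowerBoundInst_law, Measure.prod_dirac, ae_map_iff (by fun_prop)
    (measurableSet_eq_fun measurable_snd measurable_const)]
  simp

/-- The left side is the divergence between Bernoulli laws of means `p` and `1 - p`. Use `log t ≤ t
- 1`, then `1 / p ≤ 4` and `(1 - 2p)² = 4 (1/2 - p)²`. -/
lemma log_mul_one_sub_two_mul_le {p : ℝ} (hp : 1 / 4 ≤ p) (hp2 : p ≤ 1 / 2) :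
    Real.log ((1 - p) / p) * (1 - 2 * p) ≤ 16 * (1 / 2 - p) ^ 2 := by
  have hp0 : 0 < p := by linarith
  have h1 : Real.log ((1 - p) / p) ≤ (1 - p) / p - 1 :=
    Real.log_le_sub_one_of_pos (div_pos (by linarith) hp0)
  have h2 : (1 - p) / p - 1 ≤ 4 * (1 - 2 * p) := by
    rw [sub_le_iff_le_add, div_le_iff₀ hp0]
    nlinarith
  nlinarith [mul_le_mul_of_nonneg_right (h1.trans h2) (by linarith : 0 ≤ 1 - 2 * p)]

/-- The sum of the error probabilities on `Q^{(1)}` and `Q^{(i)}` is at least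
`exp (- 16 (1 / 2 - r_i)² E T_i) / 2`. -/
lemma half_exp_le_error_add_error (hr_first : (r ⟨0, pos_of_two_le hK⟩ : ℝ) = 1 / 2) {i : Fin K}
    (hi : i ≠ ⟨0, pos_of_two_le hK⟩) (hri : (1 / 4 : ℝ) ≤ r i) (hri2 : (r i : ℝ) ≤ 1 / 2)
    (S : Strategy K L) {N : ℕ}
    (hN : ∀ᵐ ω ∂(S.trajLaw (lowerBoundInst hK C r d ⟨0, pos_of_two_le hK⟩)), S.tau ω ≤ N) :
    1 / 2 * Real.exp (-(16 * ((∫ ω, S.pullCount i N ω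
        ∂(S.trajLaw (lowerBoundInst hK C r d ⟨0, pos_of_two_le hK⟩))) * (1 / 2 - r i) ^ 2))) ≤
      (S.trajLaw (lowerBoundInst hK C r d i)).real {ω | S.recommend ω ≠ i} +
        (S.trajLaw (lowerBoundInst hK C r d ⟨0, pos_of_two_le hK⟩)).real
          {ω | S.recommend ω ≠ ⟨0, pos_of_two_le hK⟩} := by
  have h0 : 0 < (r i : ℝ) := by linarith
  have h1 : (r i : ℝ) < 1 := by linarith
  have h1' : 0 < 1 - (r i : ℝ) := by linarith
  set Q := lowerBoundInst hK C r d ⟨0, pos_of_two_le hK⟩ with hQdef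
  set Q' := lowerBoundInst hK C r d i
  let f : Fin K → Outcome L → ℝ := flipRatio (r i) i
  have hfm : ∀ k, Measurable (f k) := measurable_flipRatio _ _
  have hf0 : ∀ k x, 0 < f k x := flipRatio_pos h0 h1 _
  have hQ : ∀ k, Q'.law k = (Q.law k).withDensity fun x => ENNReal.ofReal (f k x) := fun k =>
    lowerBoundInst_law_eq_withDensity hK C d hr_first i k h0 h1
  have hdensity := fun {E} => S.setLIntegral_exp_stoppedLogLikelihood_le hfm hf0 hQ hN (E := E)
  have hlaw : (Q.law i).real {x : Outcome L | x.1 = 1} = r i := by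
    rw [hQdef, lowerBoundInst_law, flippedMean_zero hK hr_first, bernoulliMeasure_prod_dirac]
    exact bernoulliMeasure_real_apply_of_mem_of_notMem _ measurableSet_fst_eq_one (by simp)
      (by simp)
  obtain ⟨hint, hmean⟩ := S.integral_stoppedLogLikelihood Q (f := f) i
    (fun k hk x => by simp [f, flipRatio, hk]) measurableSet_fst_eq_one
    (Real.log ((1 - r i) / r i)) (fun x hx => by simp_all [f, flipRatio])
    (fun x hx => by
      have : x.1 ≠ 1 := hx
      simp only [f, flipRatio, this, if_true, if_false]
      rw [← Real.log_inv, inv_div]) N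
  rw [hlaw] at hmean
  have hT0 : 0 ≤ ∫ ω, S.pullCount i N ω ∂(S.trajLaw Q) :=
    integral_nonneg fun ω => Finset.sum_nonneg fun t _ => Set.indicator_nonneg (by simp) _
  -- Recommending arm 1 is an error on `Q'` because `i ≠ 1`; the complementary event is the error on
  -- `Q`.
  have hE : MeasurableSet[S.isStoppingTime_tau.measurableSpace]
      {ω | S.recommend ω = ⟨0, pos_of_two_le hK⟩} :=
    S.measurable_recommend (measurableSet_singleton (⟨0, pos_of_two_le hK⟩ : Fin K))
  have hbh := half_exp_integral_le_setLIntegral_exp_add (S.trajLaw Q)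
    (S.measurable_stoppedLogLikelihood hfm N) hint
    (by simpa using hdensity (E := Set.univ) MeasurableSet.univ)
    (S.isStoppingTime_tau.measurableSpace_le _ hE)
  refine le_trans ?_ (hbh.trans (add_le_add ?_ (le_of_eq rfl)))
  · refine mul_le_mul_of_nonneg_left (Real.exp_le_exp.2 ?_) (by norm_num)
    rw [hmean]
    nlinarith [mul_le_mul_of_nonneg_right (log_mul_one_sub_two_mul_le hri hri2) hT0]
  · refine (ENNReal.toReal_mono (measure_ne_top _ _) (hdensity hE)).trans
      (measureReal_mono fun ω hω => ?_)
    have hω' : S.recommend ω = ⟨0, pos_of_two_le hK⟩ := hω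
    exact fun h => hi (h.symm.trans hω')

end BAIwRC

end

theorem theorem3 (K L : ℕ) (hK : 2 ≤ K) (hL : 1 ≤ L)
    (r : Fin K → unitInterval)
    (hr_first : (r ⟨0, by omega⟩ : ℝ) = 1 / 2) (hr_anti : Antitone r)
    (hr_ge : ∀ k, (1 / 4 : ℝ) ≤ r k)
    (d : Fin L → Fin K → ℝ)
    (hd_anti : ∀ l, Antitone (d l)) (hd_mem : ∀ l k, d l k ∈ Set.Ioc (0 : ℝ) 1) :
    ∃ C₀ : ℝ, ∀ C : Fin L → ℝ, (∀ l, C₀ ≤ C l) →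
      ∀ S : BAIwRC.Strategy K L,
        (∀ i, S.Feasible (BAIwRC.lowerBoundInst hK C r d i)) →
        ∃ i : Fin K,
          1 / 6 * Real.exp (-122 * (BAIwRC.lowerBoundInst hK C r d i).gammaDet.toReal) ≤
            (S.trajLaw (BAIwRC.lowerBoundInst hK C r d i)).real {ω | S.recommend ω ≠ i} := by
  -- The argument is not asymptotic: nonnegative budgets are enough.
  refine ⟨0, fun C hC S hS => ?_⟩
  have hd0 : ∀ l k, 0 < d l k := fun l k => (hd_mem l k).1
  have hv0 : ∀ k l, 0 < BAIwRC.arrangedConsumption hK d l k := fun k l => by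
    rw [BAIwRC.arrangedConsumption_eq_comp_swap]; exact hd0 _ _
  obtain ⟨N, hN, hbudget⟩ := (hS ⟨0, by omega⟩).exists_horizon hL
    (BAIwRC.ae_consumption_lowerBoundInst hK C d _) hv0
  obtain ⟨i, hi, hTi⟩ := BAIwRC.exists_arm_mul_sq_gap_le hK C hL hC hr_first hr_anti hd_anti hd0
    (fun k => MeasureTheory.integral_nonneg fun ω =>
      Finset.sum_nonneg fun t _ => Set.indicator_nonneg (by simp) _) hbudget
  have hri2 : (r i : ℝ) ≤ 1 / 2 := by
    rw [← hr_first]; exact hr_anti (Fin.mk_le_of_le_val (Nat.zero_le _))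
  have herr := BAIwRC.half_exp_le_error_add_error hK C d hr_first hi (hr_ge i) hri2 S hN
  have hγ : (BAIwRC.lowerBoundInst hK C r d ⟨0, by omega⟩).gammaDet.toReal ≤
      (BAIwRC.lowerBoundInst hK C r d i).gammaDet.toReal :=
    ENNReal.toReal_mono (BAIwRC.gammaDet_ne_top hK C hL hd_anti hd0 i)
      (BAIwRC.gammaDet_zero_le hK C hr_first hr_anti hd_anti i)
  have hγ0 : 0 ≤ (BAIwRC.lowerBoundInst hK C r d ⟨0, by omega⟩).gammaDet.toReal :=
    ENNReal.toReal_nonneg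
  have hexp := (mul_le_mul_of_nonneg_left (Real.exp_le_exp.2 (neg_le_neg
    (mul_le_mul_of_nonneg_left hTi (by norm_num : (0 : ℝ) ≤ 16))))
    (by norm_num : (0 : ℝ) ≤ 1 / 2)).trans herr
  -- Both errors would be below `exp (-32 γ^det(Q^{(1)})) / 6`, where `32 = 16 · 2` and `122` leaves
  -- slack; their sum would fall short of the `1/2` multiple in `hexp`.
  by_contra! hcon
  have h1 := hcon i
  have h2 := hcon ⟨0, by omega⟩
  have h3 := Real.exp_le_exp.2 (show -122 * (BAIwRC.lowerBoundInst hK C r d i).gammaDet.toReal ≤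
    -(16 * (2 * (BAIwRC.lowerBoundInst hK C r d ⟨0, by omega⟩).gammaDet.toReal)) by linarith)
  have h4 := Real.exp_le_exp.2 (show
    -122 * (BAIwRC.lowerBoundInst hK C r d ⟨0, by omega⟩).gammaDet.toReal ≤
    -(16 * (2 * (BAIwRC.lowerBoundInst hK C r d ⟨0, by omega⟩).gammaDet.toReal)) by linarith)
  have h5 := Real.exp_pos
    (-(16 * (2 * (BAIwRC.lowerBoundInst hK C r d ⟨0, by omega⟩).gammaDet.toReal)))
  linarith
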